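/- Let $1<\alpha<2$, $0\le\beta\le1$, $\gamma=\alpha+2\beta-\alpha\beta$, $T>0$, and for $i=1,\dots,m$ let $\eta_i,\delta_i>0$, $\sigma_i,\mu_i\in\mathbb R$, $\xi_i\in(0,T)$ with $\mu_i+\frac{\gamma-1}{\eta_i}+1>0$. For $a>0$ let $\mathcal I^a y(t)=\frac1{\Gamma(a)}\int_0^t(t-s)^{a-1}y(s)\,ds$ be the Riemann–Liouville integral, $\mathcal I^0$ the identity, and let $$\mathcal I_\eta^{\mu,\delta}y(t)=\frac{\eta t^{-\eta(\delta+\mu)}}{\Gamma(\delta)}\int_0^t\frac{s^{\eta\mu+\eta-1}y(s)}{(t^\eta-s^\eta)^{1-\delta}}\,ds$$ be the Erdélyi–Kober integral. Let ${}^H\mathcal D^{\alpha,\beta}=\mathcal I^{\rho}\,\mathcal D^2\,\mathcal I^{2-\gamma}$, where $\rho=\beta(2-\alpha)$, $2-\gamma=(1-\beta)(2-\alpha)$, $\mathcal D=d/dt$, be the Hilfer derivative of order $\alpha$ and type $\beta$, in the following sense: ${}^H\mathcal D^{\alpha,\beta}x=h$ on $[0,T]$ means that $y=\mathcal I^{2-\gamma}x$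 is $C^1$ on $[0,T]$ and $\frac{d}{dt}\,\mathcal I^{\rho}\big(y'-y'(0)\big)(t)=h(t)$ for all $t\in[0,T]$ (one-sided derivatives at the end points). That is, the outer operator $\mathcal I^{\rho}\mathcal D$ applied to $y'$ is the Caputo derivative of order $1-\rho$ of the continuous function $y'$; if $y'$ is absolutely continuous and $h$ is continuous, this says exactly that $\mathcal I^{\rho}y''=h$ almost everywhere on $[0,T]$. Assume $$\Delta=T^{\gamma-1}-\sum_{i=1}^m\sigma_i\xi_i^{\gamma-1}\frac{\Gamma(\mu_i+(\gamma-1)/\eta_i+1)}{\Gamma(\mu_i+(\gamma-1)/\eta_i+\delta_i+1)}\neq0 .$$ Let $f:[0,T]\times\mathbb R\to\mathbb R$ satisfy: (H1) $f$ is continuous; (H2) there is $L>0$ with $|f(t,x)-f(t,y)|\le L|x-y|$ for all $t\in[0,T]$, $x,y\in\mathbb R$; (H3) there is a continuous $\psi:[0,T]\to[0,\infty)$ with $|f(t,x)|\le\psi(t)$ for all $(t,x)\in[0,T]\times\mathbb R$. If $L\Lambda<1$, where $$\Lambda=\frac1{\Gamma(\alpha+1)}\left(\frac{T^{\gamma+\alpha-1}}{|\Delta|}+\frac{T^{\gamma-1}}{|\Delta|}\sum_{i=1}^m\frac{|\sigma_i|\,\xi_i^{\alpha}\,\Gamma(\alpha/\eta_i+\mu_i+1)}{\Gamma(\delta_i+\alpha/\eta_i+\mu_i+1)}\right),$$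 then the boundary value problem $${}^H\mathcal D^{\alpha,\beta}x(t)=f(t,x(t)),\ t\in[0,T],\qquad x(0)=0,\qquad x(T)=\sum_{i=1}^m\sigma_i\,\mathcal I_{\eta_i}^{\mu_i,\delta_i}x(\xi_i)$$ has at least one solution $x\in C([0,T],\mathbb R)$; in particular, the integrals defining $\mathcal I_{\eta_i}^{\mu_i,\delta_i}x(\xi_i)$ converge absolutely. -/

import Mathlib

open Set MeasureTheory

noncomputable section

/-- The Riemann-Liouville fractional integral of order `a`, with base point `0`:
`(1 / Γ(a)) ∫₀ᵗ (t - s)^(a - 1) y(s) ds` for `a > 0`, and the identity for `a = 0`. -/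
def rlIntegral (a : ℝ) (y : ℝ → ℝ) (t : ℝ) : ℝ :=
  if a = 0 then y t
  else (1 / Real.Gamma a) * ∫ s in (0 : ℝ)..t, (t - s) ^ (a - 1) * y s

/-- `h` is on `[0, T]` the Hilfer fractional derivative `I^{β(2-α)} D² I^{(1-β)(2-α)} x`, of order
`α ∈ (1, 2)` and type `β ∈ [0, 1]`, of `x`. Here `y = I^{(1-β)(2-α)} x` is required to be `C¹` on
`[0, T]` (one-sided derivatives at the end points), with derivative `u`; and, with `ρ = β(2-α)`,
the outer operator `I^ρ D`, which is the Caputo derivative of order `1 - ρ`, is the Caputo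
derivative of a continuous function in its usual form `I^ρ D u = D I^ρ (u - u(0))`.
`hasHilferDerivOn_iff_comp` below says that this is literally the composition as soon as the
second derivative of `y` exists as an integrable function with primitive `u`. -/
def HasHilferDerivOn (α β T : ℝ) (x h : ℝ → ℝ) : Prop :=
  ∃ u : ℝ → ℝ, ContinuousOn u (Icc 0 T) ∧
    (∀ t ∈ Icc (0 : ℝ) T,
      HasDerivWithinAt (rlIntegral ((1 - β) * (2 - α)) x) (u t) (Icc 0 T) t) ∧
    (∀ t ∈ Icc (0 : ℝ) T,
      HasDerivWithinAt (rlIntegral (β * (2 - α)) (fun s => u s - u 0)) (h t) (Icc 0 T) t)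

/-- The fractional integral of an integrable function is integrable, and fractional integration
commutes with taking the primitive vanishing at `0`. -/
theorem rlIntegral_primitive {a T : ℝ} (ha : 0 ≤ a) (hT : 0 < T) {g : ℝ → ℝ}
    (hg : IntervalIntegrable g volume 0 T) :
    IntervalIntegrable (rlIntegral a g) volume 0 T ∧
      ∀ t ∈ Icc (0 : ℝ) T,
        rlIntegral a (fun s => ∫ τ in (0 : ℝ)..s, g τ) t = ∫ s in (0 : ℝ)..t, rlIntegral a g s := by
  rcases ha.eq_or_lt with h0 | h0
  · subst h0
    have : rlIntegral 0 g = g := by funext t; simp [rlIntegral]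
    rw [this]
    exact ⟨hg, fun t _ => by simp [rlIntegral]⟩
  have hne : a ≠ 0 := h0.ne'
  set K : ℝ → ℝ := indicator (Ioc 0 T) (fun r => r ^ (a - 1)) with hK
  set G : ℝ → ℝ := indicator (Ioc 0 T) g with hG
  have hKi : Integrable K := by
    rw [hK, integrable_indicator_iff measurableSet_Ioc,
      ← intervalIntegrable_iff_integrableOn_Ioc_of_le hT.le]
    exact intervalIntegral.intervalIntegrable_rpow' (by linarith)
  have hGi : Integrable G := by
    rw [hG, integrable_indicator_iff measurableSet_Ioc,
      ← intervalIntegrable_iff_integrableOn_Ioc_of_le hT.le]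
    exact hg
  have hF : Integrable (fun p : ℝ × ℝ => K p.2 * G (p.1 - p.2)) (volume.prod volume) := by
    simpa using hKi.convolution_integrand (ContinuousLinearMap.mul ℝ ℝ) hGi
  have hinner : ∀ s ∈ Icc (0 : ℝ) T,
      ∫ r, K r * G (s - r) = ∫ τ in (0 : ℝ)..s, (s - τ) ^ (a - 1) * g τ := by
    intro s hs
    have e : (fun r => K r * G (s - r)) =
        indicator (Ioo 0 s) (fun r => r ^ (a - 1) * g (s - r)) := by
      funext r
      by_cases hr : r ∈ Ioo 0 s
      · have h1 : r ∈ Ioc 0 T := ⟨hr.1, by linarith [hr.2, hs.2]⟩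
        have h2 : s - r ∈ Ioc 0 T := ⟨by linarith [hr.2], by linarith [hr.1, hs.2]⟩
        simp [hK, hG, indicator_of_mem, hr, h1, h2]
      · rw [indicator_of_notMem hr]
        by_cases h1 : r ∈ Ioc 0 T
        · have h2 : s - r ∉ Ioc 0 T := fun h => hr ⟨h1.1, by linarith [h.1]⟩
          simp [hG, indicator_of_notMem h2]
        · simp [hK, indicator_of_notMem h1]
    rw [e, integral_indicator measurableSet_Ioo, ← integral_Ioc_eq_integral_Ioo,
      ← intervalIntegral.integral_of_le hs.1]
    have := intervalIntegral.integral_comp_sub_left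
      (fun τ => (s - τ) ^ (a - 1) * g τ) s (a := 0) (b := s)
    simpa using this
  have hrl : ∀ s ∈ Icc (0 : ℝ) T,
      rlIntegral a g s = (1 / Real.Gamma a) * ∫ r, K r * G (s - r) := by
    intro s hs
    rw [hinner s hs, rlIntegral, if_neg hne]
  have hJ : Integrable (fun s => (1 / Real.Gamma a) * ∫ r, K r * G (s - r)) :=
    hF.integral_prod_left.const_mul _
  refine ⟨?_, ?_⟩
  · rw [intervalIntegrable_iff_integrableOn_Ioc_of_le hT.le]
    exact (hJ.integrableOn (s := Ioc 0 T)).congr_fun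
      (fun s hs => (hrl s ⟨hs.1.le, hs.2⟩).symm) measurableSet_Ioc
  · intro t ht
    have hR : ∫ s in (0 : ℝ)..t, rlIntegral a g s =
        (1 / Real.Gamma a) * ∫ s in Ioc 0 t, ∫ r, K r * G (s - r) := by
      rw [intervalIntegral.integral_of_le ht.1, ← integral_const_mul]
      exact setIntegral_congr_fun measurableSet_Ioc
        (fun s hs => hrl s ⟨hs.1.le, hs.2.trans ht.2⟩)
    rw [hR, rlIntegral, if_neg hne]
    congr 1
    have hF' : Integrable (Function.uncurry fun s r => K r * G (s - r))
        ((volume.restrict (Ioc 0 t)).prod volume) := by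
      have h := hF.integrableOn (s := Ioc 0 t ×ˢ univ)
      rw [IntegrableOn, ← Measure.prod_restrict, Measure.restrict_univ] at h
      exact h
    rw [integral_integral_swap hF']
    have e : (fun r => ∫ s in Ioc 0 t, K r * G (s - r)) =
        indicator (Ioc 0 t) (fun r => r ^ (a - 1) * ∫ τ in (0 : ℝ)..(t - r), g τ) := by
      funext r
      rw [integral_const_mul]
      by_cases h1 : r ∈ Ioc 0 T
      · have h2 : ∫ s in Ioc 0 t, G (s - r) = ∫ τ in Ioc 0 (t - r), g τ := by
          rw [← intervalIntegral.integral_of_le ht.1,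
            intervalIntegral.integral_comp_sub_right G r,
            intervalIntegral.integral_of_le (by linarith [ht.1]), hG,
            setIntegral_indicator measurableSet_Ioc]
          congr 2
          ext z
          constructor
          · rintro ⟨hz, hz'⟩
            exact ⟨hz'.1, hz.2⟩
          · intro hz
            exact ⟨⟨by linarith [h1.1, hz.1], hz.2⟩, hz.1, by linarith [hz.2, h1.1, ht.2]⟩
        rw [h2, hK, indicator_of_mem h1]
        by_cases h3 : r ≤ t
        · rw [indicator_of_mem (show r ∈ Ioc 0 t from ⟨h1.1, h3⟩),
            intervalIntegral.integral_of_le (by linarith)]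
        · rw [indicator_of_notMem (fun h => h3 h.2), Ioc_eq_empty (by linarith)]
          simp
      · rw [hK, indicator_of_notMem h1,
          indicator_of_notMem (fun h => h1 ⟨h.1, h.2.trans ht.2⟩), zero_mul]
    rw [e, integral_indicator measurableSet_Ioc, ← intervalIntegral.integral_of_le ht.1]
    have := intervalIntegral.integral_comp_sub_left
      (fun s => (t - s) ^ (a - 1) * ∫ τ in (0 : ℝ)..s, g τ) t (a := 0) (b := t)
    simpa using this.symm

/-- If `y = I^{(1-β)(2-α)} x` has a derivative `u` which is the primitive of an integrable function
`g` (so that `g = D² y` almost everywhere), then `h` is the Hilfer derivative of `x` if and only if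
`I^{β(2-α)} g = h` almost everywhere. -/
theorem hasHilferDerivOn_iff_comp {α β T : ℝ} (hα : α < 2) (hβ : 0 ≤ β) (hT : 0 < T)
    {x h u g : ℝ → ℝ} (hh : ContinuousOn h (Icc 0 T))
    (hu : ∀ t ∈ Icc (0 : ℝ) T,
      HasDerivWithinAt (rlIntegral ((1 - β) * (2 - α)) x) (u t) (Icc 0 T) t)
    (hg : IntervalIntegrable g volume 0 T)
    (hug : ∀ t ∈ Icc (0 : ℝ) T, u t = u 0 + ∫ s in (0 : ℝ)..t, g s) :
    HasHilferDerivOn α β T x h ↔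
      ∀ᵐ t ∂(volume.restrict (Icc 0 T)), rlIntegral (β * (2 - α)) g t = h t := by
  have hρ : 0 ≤ β * (2 - α) := mul_nonneg hβ (by linarith)
  obtain ⟨hi, hprim⟩ := rlIntegral_primitive hρ hT hg
  have hcongr : ∀ v : ℝ → ℝ, (∀ t ∈ Icc (0 : ℝ) T, v t = u t) → ∀ t ∈ Icc (0 : ℝ) T,
      rlIntegral (β * (2 - α)) (fun s => v s - v 0) t =
        ∫ s in (0 : ℝ)..t, rlIntegral (β * (2 - α)) g s := by
    intro v hv t ht
    rw [← hprim t ht]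
    have hv' : ∀ s ∈ Icc (0 : ℝ) T, v s - v 0 = ∫ τ in (0 : ℝ)..s, g τ := by
      intro s hs
      rw [hv s hs, hv 0 ⟨le_rfl, hT.le⟩, hug s hs]
      ring
    simp only [rlIntegral]
    split_ifs
    · exact hv' t ht
    · congr 1
      apply intervalIntegral.integral_congr
      intro s hs
      rw [uIcc_of_le ht.1] at hs
      simp only
      rw [hv' s ⟨hs.1, hs.2.trans ht.2⟩]
  have hhi : IntervalIntegrable h volume 0 T := by
    apply ContinuousOn.intervalIntegrable
    rwa [uIcc_of_le hT.le]
  constructor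
  · rintro ⟨v, -, hv, hv'⟩
    have huv : ∀ t ∈ Icc (0 : ℝ) T, v t = u t := fun t ht =>
      (uniqueDiffOn_Icc hT t ht).eq_deriv _ (hv t ht) (hu t ht)
    have hc := hcongr v huv
    have hae := hi.ae_hasDerivAt_integral
    rw [← restrict_Ioo_eq_restrict_Icc]
    rw [ae_restrict_iff' measurableSet_Ioo]
    filter_upwards [hae] with t ht hts
    have hts' : t ∈ Icc (0 : ℝ) T := Ioo_subset_Icc_self hts
    have h1 := ht (by rwa [uIcc_of_le hT.le]) 0 (by rw [uIcc_of_le hT.le]; exact ⟨le_rfl, hT.le⟩)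
    have h2 : HasDerivWithinAt (fun z => ∫ s in (0 : ℝ)..z, rlIntegral (β * (2 - α)) g s) (h t)
        (Icc 0 T) t := (hv' t hts').congr (fun z hz => (hc z hz).symm) (hc t hts').symm
    exact (uniqueDiffOn_Icc hT t hts').eq_deriv _ h1.hasDerivWithinAt h2
  · intro hae
    refine ⟨u, ?_, hu, ?_⟩
    · have h1 : ContinuousOn (fun t => u 0 + ∫ s in (0 : ℝ)..t, g s) (Icc 0 T) := by
        have := intervalIntegral.continuousOn_primitive_interval
          (f := g) (μ := volume) (a := 0) (b := T)
          (by rw [uIcc_of_le hT.le, integrableOn_Icc_iff_integrableOn_Ioc,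
                ← intervalIntegrable_iff_integrableOn_Ioc_of_le hT.le]; exact hg)
        rw [uIcc_of_le hT.le] at this
        exact continuousOn_const.add this
      exact h1.congr hug
    · intro t ht
      have h1 : ∀ z ∈ Icc (0 : ℝ) T,
          rlIntegral (β * (2 - α)) (fun s => u s - u 0) z = ∫ s in (0 : ℝ)..z, h s := by
        intro z hz
        rw [hcongr u (fun _ _ => rfl) z hz, intervalIntegral.integral_of_le hz.1,
          intervalIntegral.integral_of_le hz.1]
        apply integral_congr_ae
        exact ae_restrict_of_ae_restrict_of_subset
          (show Ioc 0 z ⊆ Icc 0 T from fun s hs => ⟨hs.1.le, hs.2.trans hz.2⟩) hae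
      have h2 : HasDerivWithinAt (fun z => ∫ s in (0 : ℝ)..z, h s) (h t) (Icc 0 T) t := by
        have : Fact (t ∈ Icc (0 : ℝ) T) := ⟨ht⟩
        apply intervalIntegral.integral_hasDerivWithinAt_right
        · exact hhi.mono_set (by
            rw [uIcc_of_le ht.1, uIcc_of_le hT.le]; exact Icc_subset_Icc le_rfl ht.2)
        · exact hh.stronglyMeasurableAtFilter_nhdsWithin measurableSet_Icc t
        · exact hh t ht
      exact h2.congr h1 (h1 t ht)

/-- The integrand of the Erdélyi-Kober fractional integral at the point `t`. -/
def ekIntegrand (η μ δ : ℝ) (y : ℝ → ℝ) (t s : ℝ) : ℝ :=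
  s ^ (η * μ + η - 1) * y s / (t ^ η - s ^ η) ^ (1 - δ)

/-- The Erdélyi-Kober fractional integral of order `δ > 0`, with `η > 0` and `μ` real. -/
def erdelyiKober (η μ δ : ℝ) (y : ℝ → ℝ) (t : ℝ) : ℝ :=
  η * t ^ (-η * (δ + μ)) / Real.Gamma δ * ∫ s in (0 : ℝ)..t, ekIntegrand η μ δ y t s

/-- `γ = α + 2β - αβ`. -/
def hilferGamma (α β : ℝ) : ℝ := α + 2 * β - α * β

/-- The constant `Δ`. -/
def bvpDelta (α β T : ℝ) {m : ℕ} (σ η μ δ ξ : Fin m → ℝ) : ℝ :=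
  T ^ (hilferGamma α β - 1) -
    ∑ i, σ i * ξ i ^ (hilferGamma α β - 1) *
      (Real.Gamma (μ i + (hilferGamma α β - 1) / η i + 1) /
        Real.Gamma (μ i + (hilferGamma α β - 1) / η i + δ i + 1))

/-- The constant `Λ`. -/
def bvpLambda (α β T : ℝ) {m : ℕ} (σ η μ δ ξ : Fin m → ℝ) : ℝ :=
  (1 / Real.Gamma (α + 1)) *
    (T ^ (hilferGamma α β + α - 1) / |bvpDelta α β T σ η μ δ ξ| +
      T ^ (hilferGamma α β - 1) / |bvpDelta α β T σ η μ δ ξ| *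
        ∑ i, |σ i| * ξ i ^ α * Real.Gamma (α / η i + μ i + 1) /
          Real.Gamma (δ i + α / η i + μ i + 1))

/-- `x` is a solution on `[0, T]` of the Hilfer boundary value problem
`D^{α,β} x(t) = f(t, x(t))`, `x(0) = 0`, `x(T) = ∑ᵢ σᵢ I_{ηᵢ}^{μᵢ,δᵢ} x(ξᵢ)`. -/
structure IsBVPSolution (α β T : ℝ) {m : ℕ} (σ η μ δ ξ : Fin m → ℝ) (f : ℝ → ℝ → ℝ)
    (x : ℝ → ℝ) : Prop where
  continuousOn : ContinuousOn x (Icc 0 T)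
  equation : HasHilferDerivOn α β T x (fun t => f t (x t))
  left_boundary : x 0 = 0
  ek_defined : ∀ i, IntervalIntegrable (ekIntegrand (η i) (μ i) (δ i) x (ξ i)) volume 0 (ξ i)
  right_boundary : x T = ∑ i, σ i * erdelyiKober (η i) (μ i) (δ i) x (ξ i)

end

/-! ### The beta integral -/

/-! The proof is a shooting argument in one real parameter. Every `x = c t^(γ-1) + I^α F` with `F`
continuous satisfies `x(0) = 0` and has Hilfer derivative `F` (`hasHilferDerivOn_of_eq`): `I^(2-γ)`
turns `t^(γ-1)` into a multiple of `t`, whose slope is cancelled by subtracting `u(0)`, and the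
semigroup law `I^a I^b = I^(a+b)` (`rlIntegral_rlIntegral`) handles `I^α F`. For each `c` the
Volterra equation `x = c t^(γ-1) + I^α f(·, x)` has a solution `X c` that is Lipschitz in `c`, by
contraction in an exponentially weighted norm (`exists_volterra_family`).

It remains to choose `c`. An Erdélyi-Kober integral multiplies a power by a quotient of Gamma values
(`erdelyiKober_rpow`), so with `F c = f(·, X c)` the right boundary condition reads `c Δ = ∑ σᵢ
I_{ηᵢ}^{μᵢ,δᵢ} I^α (F c)(ξᵢ) - I^α (F c)(T)`, that is, `c = bvpCoeff (F c)`. The right side is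
continuous in `c` because `f` is Lipschitz, and bounded in `c` because `|f| ≤ ψ`
(`exists_abs_bvpCoeff_sub_le`). A bounded continuous map of the line has a fixed point. -/

theorem beta_integrand_scaled {a b t x : ℝ} (ht : 0 < t) (hx : x ∈ Icc (0 : ℝ) 1) :
    (t - t * x) ^ (a - 1) * (t * x) ^ (b - 1) =
      t ^ (a + b - 2) * (x ^ (b - 1) * (1 - x) ^ (a - 1)) := by
  have h1 : t - t * x = t * (1 - x) := by ring
  have h2 : a + b - 2 = (a - 1) + (b - 1) := by ring
  rw [h1, Real.mul_rpow ht.le (by linarith [hx.2]), Real.mul_rpow ht.le hx.1, h2,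
    Real.rpow_add ht]
  ring

theorem beta_integrand_ofReal {a b x : ℝ} (hx : x ∈ Icc (0 : ℝ) 1) :
    (x : ℂ) ^ ((b : ℂ) - 1) * (1 - (x : ℂ)) ^ ((a : ℂ) - 1) =
      ((x ^ (b - 1) * (1 - x) ^ (a - 1) : ℝ) : ℂ) := by
  push_cast
  rw [Complex.ofReal_cpow hx.1, Complex.ofReal_cpow (by linarith [hx.2])]
  push_cast
  rfl

theorem intervalIntegrable_beta_unit {a b : ℝ} (ha : 0 < a) (hb : 0 < b) :
    IntervalIntegrable (fun x : ℝ => x ^ (b - 1) * (1 - x) ^ (a - 1)) volume 0 1 := by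
  have h := Complex.betaIntegral_convergent (u := b) (v := a) (by simpa) (by simpa)
  rw [intervalIntegrable_iff_integrableOn_Ioc_of_le zero_le_one] at h ⊢
  refine (IntegrableOn.congr_fun h.re (fun x hx => ?_) measurableSet_Ioc)
  rw [beta_integrand_ofReal (Ioc_subset_Icc_self hx)]
  simp

theorem integral_beta_unit {a b : ℝ} (ha : 0 < a) (hb : 0 < b) :
    ∫ x in (0 : ℝ)..1, x ^ (b - 1) * (1 - x) ^ (a - 1) =
      Real.Gamma a * Real.Gamma b / Real.Gamma (a + b) := by
  have h := ProbabilityTheory.beta_eq_betaIntegralReal b a hb ha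
  rw [ProbabilityTheory.beta, Complex.betaIntegral] at h
  rw [mul_comm (Real.Gamma a), add_comm a, h, ← Complex.ofReal_re
    (∫ x in (0 : ℝ)..1, x ^ (b - 1) * (1 - x) ^ (a - 1)), ← intervalIntegral.integral_ofReal]
  congr 1
  refine intervalIntegral.integral_congr fun x hx => ?_
  rw [uIcc_of_le zero_le_one] at hx
  exact (beta_integrand_ofReal hx).symm

theorem intervalIntegrable_beta {a b t : ℝ} (ha : 0 < a) (hb : 0 < b) (ht : 0 < t) :
    IntervalIntegrable (fun s : ℝ => (t - s) ^ (a - 1) * s ^ (b - 1)) volume 0 t := by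
  have h : IntervalIntegrable (fun x : ℝ => (t - t * x) ^ (a - 1) * (t * x) ^ (b - 1))
      volume 0 1 := by
    refine ((intervalIntegrable_beta_unit ha hb).const_mul (t ^ (a + b - 2))).congr ?_
    intro x hx
    rw [uIoc_of_le zero_le_one] at hx
    exact (beta_integrand_scaled ht (Ioc_subset_Icc_self hx)).symm
  have h' := h.comp_mul_left (c := t⁻¹)
  have e : (fun x : ℝ => (t - t * (t⁻¹ * x)) ^ (a - 1) * (t * (t⁻¹ * x)) ^ (b - 1)) =
      fun s : ℝ => (t - s) ^ (a - 1) * s ^ (b - 1) := by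
    funext x
    rw [mul_inv_cancel_left₀ ht.ne']
  simpa [e] using h'

theorem integral_beta {a b t : ℝ} (ha : 0 < a) (hb : 0 < b) (ht : 0 < t) :
    ∫ s in (0 : ℝ)..t, (t - s) ^ (a - 1) * s ^ (b - 1) =
      t ^ (a + b - 1) * (Real.Gamma a * Real.Gamma b / Real.Gamma (a + b)) := by
  have h := intervalIntegral.mul_integral_comp_mul_left (a := 0) (b := 1) (c := t)
    (f := fun s : ℝ => (t - s) ^ (a - 1) * s ^ (b - 1))
  rw [mul_zero, mul_one] at h
  have e : a + b - 1 = 1 + (a + b - 2) := by ring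
  rw [← h, ← integral_beta_unit ha hb, e, Real.rpow_add ht, Real.rpow_one, mul_assoc,
    ← intervalIntegral.integral_const_mul (t ^ (a + b - 2))]
  congr 1
  refine intervalIntegral.integral_congr fun x hx => ?_
  rw [uIcc_of_le zero_le_one] at hx
  exact beta_integrand_scaled ht hx

/-! ### The Riemann-Liouville integral of continuous functions -/

theorem intervalIntegrable_sub_rpow {a : ℝ} (ha : 0 < a) (t : ℝ) :
    IntervalIntegrable (fun s : ℝ => (t - s) ^ (a - 1)) volume 0 t := by
  have h := (intervalIntegral.intervalIntegrable_rpow' (a := 0) (b := t) (r := a - 1)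
    (by linarith)).comp_sub_left t
  simpa using h.symm

theorem integral_sub_rpow {a : ℝ} (ha : 0 < a) (t : ℝ) :
    ∫ s in (0 : ℝ)..t, (t - s) ^ (a - 1) = t ^ a / a := by
  rw [intervalIntegral.integral_comp_sub_left (fun s => s ^ (a - 1)) t,
    integral_rpow (Or.inl (by linarith))]
  simp [ha.ne']

theorem intervalIntegrable_rlIntegrand {a t : ℝ} (ha : 0 < a) (ht : 0 ≤ t) {F : ℝ → ℝ}
    (hF : ContinuousOn F (Icc 0 t)) :
    IntervalIntegrable (fun s : ℝ => (t - s) ^ (a - 1) * F s) volume 0 t :=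
  (intervalIntegrable_sub_rpow ha t).mul_continuousOn (by rwa [uIcc_of_le ht])

theorem rlIntegral_zero (y : ℝ → ℝ) : rlIntegral 0 y = y := by
  funext t; simp [rlIntegral]

theorem rlIntegral_one (y : ℝ → ℝ) (t : ℝ) : rlIntegral 1 y t = ∫ s in (0 : ℝ)..t, y s := by
  simp [rlIntegral]

theorem rlIntegral_apply_zero {a : ℝ} (ha : 0 < a) (y : ℝ → ℝ) : rlIntegral a y 0 = 0 := by
  simp [rlIntegral, ha.ne']

theorem rlIntegral_congr {a t : ℝ} (ht : 0 ≤ t) {F G : ℝ → ℝ} (h : EqOn F G (Icc 0 t)) :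
    rlIntegral a F t = rlIntegral a G t := by
  unfold rlIntegral
  split_ifs
  · exact h ⟨ht, le_rfl⟩
  · congr 1
    refine intervalIntegral.integral_congr fun s hs => ?_
    rw [uIcc_of_le ht] at hs
    simp only [h hs]

theorem rlIntegral_add {a t : ℝ} (ha : 0 ≤ a) (ht : 0 ≤ t) {F G : ℝ → ℝ}
    (hF : ContinuousOn F (Icc 0 t)) (hG : ContinuousOn G (Icc 0 t)) :
    rlIntegral a (fun s => F s + G s) t = rlIntegral a F t + rlIntegral a G t := by
  rcases ha.eq_or_lt with rfl | ha
  · simp [rlIntegral_zero]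
  simp only [rlIntegral, if_neg ha.ne', mul_add]
  rw [intervalIntegral.integral_add (intervalIntegrable_rlIntegrand ha ht hF)
    (intervalIntegrable_rlIntegrand ha ht hG), mul_add]

theorem rlIntegral_const_mul (a c t : ℝ) (F : ℝ → ℝ) :
    rlIntegral a (fun s => c * F s) t = c * rlIntegral a F t := by
  unfold rlIntegral
  split_ifs
  · rfl
  · rw [mul_left_comm, ← intervalIntegral.integral_const_mul c]
    congr 2
    funext s
    ring

theorem rlIntegral_sub {a t : ℝ} (ha : 0 ≤ a) (ht : 0 ≤ t) {F G : ℝ → ℝ}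
    (hF : ContinuousOn F (Icc 0 t)) (hG : ContinuousOn G (Icc 0 t)) :
    rlIntegral a (fun s => F s - G s) t = rlIntegral a F t - rlIntegral a G t := by
  have h := rlIntegral_add ha ht hF (hG.const_mul (-1))
  rw [rlIntegral_const_mul] at h
  simpa [sub_eq_add_neg] using h

theorem abs_rlIntegral_le {a t M : ℝ} (ha : 0 ≤ a) (ht : 0 ≤ t) {F : ℝ → ℝ}
    (hF : ∀ s ∈ Icc 0 t, |F s| ≤ M) :
    |rlIntegral a F t| ≤ M * (t ^ a / Real.Gamma (a + 1)) := by
  rcases ha.eq_or_lt with rfl | ha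
  · simpa [rlIntegral_zero] using hF t ⟨ht, le_rfl⟩
  have hΓ := Real.Gamma_pos_of_pos ha
  have h := intervalIntegral.norm_integral_le_of_norm_le (μ := volume) ht
    (f := fun s => (t - s) ^ (a - 1) * F s) (g := fun s => (t - s) ^ (a - 1) * M)
    (Filter.Eventually.of_forall fun s hs => by
      have h0 : 0 ≤ (t - s) ^ (a - 1) := Real.rpow_nonneg (by linarith [hs.2]) _
      rw [norm_mul, Real.norm_of_nonneg h0]
      exact mul_le_mul_of_nonneg_left (hF s ⟨hs.1.le, hs.2⟩) h0)
    ((intervalIntegrable_sub_rpow ha t).mul_const M)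
  rw [intervalIntegral.integral_mul_const, integral_sub_rpow ha, Real.norm_eq_abs] at h
  rw [rlIntegral, if_neg ha.ne', abs_mul, abs_of_pos (one_div_pos.2 hΓ),
    Real.Gamma_add_one ha.ne']
  calc _ ≤ 1 / Real.Gamma a * (t ^ a / a * M) := by gcongr
    _ = _ := by field_simp

/-- The substitution `s = t r` fixes both the interval and the singularity at `r = 1`, so that `t`
enters only through `t ^ a` and `F (t * r)`. Continuity in `t` then follows by dominated
convergence. -/
theorem rlIntegral_eq_scaled {a t : ℝ} (ha : 0 < a) (ht : 0 ≤ t) (F : ℝ → ℝ) :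
    rlIntegral a F t =
      1 / Real.Gamma a * (t ^ a * ∫ r in (0 : ℝ)..1, (1 - r) ^ (a - 1) * F (t * r)) := by
  rcases ht.eq_or_lt with rfl | ht
  · rw [rlIntegral_apply_zero ha, Real.zero_rpow ha.ne']; simp
  rw [rlIntegral, if_neg ha.ne']
  have h := intervalIntegral.mul_integral_comp_mul_left (a := 0) (b := 1) (c := t)
    (f := fun s : ℝ => (t - s) ^ (a - 1) * F s)
  rw [mul_zero, mul_one] at h
  have e : t ^ a = t * t ^ (a - 1) := by
    rw [mul_comm, ← Real.rpow_add_one ht.ne', sub_add_cancel]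
  rw [← h, e, mul_assoc, ← intervalIntegral.integral_const_mul (t ^ (a - 1))]
  congr 2
  refine intervalIntegral.integral_congr fun x hx => ?_
  rw [uIcc_of_le zero_le_one] at hx
  have h1 : t - t * x = t * (1 - x) := by ring
  rw [h1, Real.mul_rpow ht.le (by linarith [hx.2]), mul_assoc]

theorem continuousOn_rlIntegral {a T : ℝ} (ha : 0 ≤ a) {F : ℝ → ℝ}
    (hF : ContinuousOn F (Icc 0 T)) : ContinuousOn (rlIntegral a F) (Icc 0 T) := by
  rcases ha.eq_or_lt with rfl | ha
  · rwa [rlIntegral_zero]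
  have hmul : ∀ t ∈ Icc 0 T, ∀ r ∈ Icc (0 : ℝ) 1, t * r ∈ Icc 0 T := fun t ht r hr =>
    ⟨mul_nonneg ht.1 hr.1, (mul_le_of_le_one_right ht.1 hr.2).trans ht.2⟩
  obtain ⟨M, hM⟩ := isCompact_Icc.exists_bound_of_continuousOn hF
  have hint : ContinuousOn (fun t => ∫ r in (0 : ℝ)..1, (1 - r) ^ (a - 1) * F (t * r))
      (Icc 0 T) := by
    intro t ht
    refine intervalIntegral.continuousWithinAt_of_dominated_interval
      (bound := fun r => (1 - r) ^ (a - 1) * M) ?_ ?_ ?_ ?_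
    · filter_upwards [self_mem_nhdsWithin] with z hz
      rw [uIoc_of_le zero_le_one]
      have := intervalIntegrable_rlIntegrand ha zero_le_one
        (F := fun r => F (z * r)) (hF.comp (by fun_prop) (fun r hr => hmul z hz r hr))
      rw [intervalIntegrable_iff_integrableOn_Ioc_of_le zero_le_one] at this
      exact this.aestronglyMeasurable
    · filter_upwards [self_mem_nhdsWithin] with z hz
      refine Filter.Eventually.of_forall fun r hr => ?_
      rw [uIoc_of_le zero_le_one] at hr
      have h0 : 0 ≤ (1 - r) ^ (a - 1) := Real.rpow_nonneg (by linarith [hr.2]) _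
      rw [norm_mul, Real.norm_of_nonneg h0]
      exact mul_le_mul_of_nonneg_left (hM _ (hmul z hz r (Ioc_subset_Icc_self hr))) h0
    · exact (intervalIntegrable_sub_rpow ha 1).mul_const M
    · refine Filter.Eventually.of_forall fun r hr => ?_
      rw [uIoc_of_le zero_le_one] at hr
      have hc : ContinuousOn (fun z => F (z * r)) (Icc 0 T) :=
        hF.comp (by fun_prop) (fun z hz => hmul z hz r (Ioc_subset_Icc_self hr))
      exact (hc t ht).const_mul _
  have h : ContinuousOn (fun t => 1 / Real.Gamma a *
      (t ^ a * ∫ r in (0 : ℝ)..1, (1 - r) ^ (a - 1) * F (t * r))) (Icc 0 T) :=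
    (((Real.continuous_rpow_const ha.le).continuousOn).mul hint).const_mul _
  exact h.congr fun t ht => rlIntegral_eq_scaled ha ht.1 F

theorem rlIntegral_rpow {a b t : ℝ} (ha : 0 ≤ a) (hb : 0 ≤ b) (ht : 0 ≤ t) :
    rlIntegral a (fun s => s ^ b) t =
      Real.Gamma (b + 1) / Real.Gamma (a + b + 1) * t ^ (a + b) := by
  have hΓb := (Real.Gamma_pos_of_pos (show 0 < b + 1 by linarith)).ne'
  rcases ha.eq_or_lt with rfl | ha
  · simp [rlIntegral_zero, hΓb]
  have hΓa := (Real.Gamma_pos_of_pos ha).ne'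
  rcases ht.eq_or_lt with rfl | ht
  · rw [rlIntegral_apply_zero ha, Real.zero_rpow (by linarith), mul_zero]
  have h := integral_beta ha (show 0 < b + 1 by linarith) ht
  rw [add_sub_cancel_right, ← add_assoc, add_sub_cancel_right] at h
  rw [rlIntegral, if_neg ha.ne', h]
  field_simp

/-- Fractional integration is a semigroup on monomials. -/
theorem rlIntegral_rlIntegral_rpow {a b c t : ℝ} (ha : 0 ≤ a) (hb : 0 ≤ b) (hc : 0 ≤ c)
    (ht : 0 ≤ t) :
    rlIntegral a (rlIntegral b fun s => s ^ c) t = rlIntegral (a + b) (fun s => s ^ c) t := by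
  rw [rlIntegral_congr ht (fun s hs => rlIntegral_rpow hb hc hs.1), rlIntegral_const_mul,
    rlIntegral_rpow ha (by linarith) ht, rlIntegral_rpow (by linarith) hc ht, ← add_assoc a b c]
  have := (Real.Gamma_pos_of_pos (show 0 < b + c + 1 by linarith)).ne'
  field_simp

/-- Dense case of the semigroup law: on monomials it is an identity between Gamma quotients, and
Weierstrass approximation extends it to continuous functions without exchanging iterated integrals.
-/
theorem rlIntegral_rlIntegral_polynomial {a b t : ℝ} (ha : 0 ≤ a) (hb : 0 ≤ b) (ht : 0 ≤ t)
    (p : Polynomial ℝ) :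
    rlIntegral a (rlIntegral b fun s => p.eval s) t = rlIntegral (a + b) (fun s => p.eval s) t := by
  induction p using Polynomial.induction_on' with
  | add p q hp hq =>
    have hcp : ∀ s, ContinuousOn (fun x => p.eval x) (Icc 0 s) :=
      fun s => p.continuous.continuousOn
    have hcq : ∀ s, ContinuousOn (fun x => q.eval x) (Icc 0 s) :=
      fun s => q.continuous.continuousOn
    simp only [Polynomial.eval_add]
    rw [rlIntegral_congr ht (fun s hs => rlIntegral_add hb hs.1 (hcp s) (hcq s)),
      rlIntegral_add ha ht (continuousOn_rlIntegral hb (hcp t))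
        (continuousOn_rlIntegral hb (hcq t)), hp, hq,
      rlIntegral_add (add_nonneg ha hb) ht (hcp t) (hcq t)]
  | monomial n c =>
    have h := rlIntegral_rlIntegral_rpow ha hb (Nat.cast_nonneg (α := ℝ) n) ht
    simp only [Real.rpow_natCast] at h
    simp only [Polynomial.eval_monomial]
    rw [rlIntegral_congr ht (fun s hs => rlIntegral_const_mul b c s fun x => x ^ n),
      rlIntegral_const_mul, rlIntegral_const_mul, h]

/-- The semigroup property of fractional integration on continuous functions. -/
theorem rlIntegral_rlIntegral {a b t : ℝ} (ha : 0 ≤ a) (hb : 0 ≤ b) (ht : 0 ≤ t) {F : ℝ → ℝ}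
    (hF : ContinuousOn F (Icc 0 t)) :
    rlIntegral a (rlIntegral b F) t = rlIntegral (a + b) F t := by
  have hΓ : ∀ c : ℝ, 0 ≤ c → 0 < Real.Gamma (c + 1) := fun c hc =>
    Real.Gamma_pos_of_pos (by linarith)
  -- `A` is the sum of the sup-norm bounds at `t` for `I^a I^b` and `I^(a+b)`. An approximation
  -- error `ε / (A + 1)` therefore costs at most `ε`; the `+ 1` keeps the denominator positive.
  set A := t ^ b / Real.Gamma (b + 1) * (t ^ a / Real.Gamma (a + 1)) +
    t ^ (a + b) / Real.Gamma (a + b + 1) with hA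
  have hA0 : 0 ≤ A := by
    have := hΓ a ha
    have := hΓ b hb
    have := hΓ (a + b) (add_nonneg ha hb)
    positivity
  refine eq_of_abs_sub_le_all fun ε hε => ?_
  obtain ⟨p, hp⟩ := exists_polynomial_near_of_continuousOn 0 t F hF (ε / (A + 1)) (by positivity)
  have hpc : ∀ s, ContinuousOn (fun x => p.eval x) (Icc 0 s) :=
    fun s => p.continuous.continuousOn
  set D : ℝ → ℝ := fun s => F s - p.eval s with hD
  have hDc : ContinuousOn D (Icc 0 t) := hF.sub (hpc t)
  have hDb : ∀ s ∈ Icc 0 t, |D s| ≤ ε / (A + 1) := fun s hs => by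
    rw [hD, abs_sub_comm]; exact (hp s hs).le
  have h1 : ∀ s ∈ Icc 0 t, |rlIntegral b D s| ≤ ε / (A + 1) * (t ^ b / Real.Gamma (b + 1)) := by
    intro s hs
    refine (abs_rlIntegral_le hb hs.1 fun x hx => hDb x ⟨hx.1, hx.2.trans hs.2⟩).trans ?_
    have := hΓ b hb
    have := Real.rpow_le_rpow hs.1 hs.2 hb
    gcongr
  have h2 := abs_rlIntegral_le ha ht h1
  have h3 := abs_rlIntegral_le (add_nonneg ha hb) ht hDb
  have e1 : rlIntegral a (rlIntegral b D) t = rlIntegral a (rlIntegral b F) t -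
      rlIntegral a (rlIntegral b fun s => p.eval s) t := by
    rw [← rlIntegral_sub ha ht (continuousOn_rlIntegral hb hF)
      (continuousOn_rlIntegral hb (hpc t))]
    exact rlIntegral_congr ht fun s hs =>
      rlIntegral_sub hb hs.1 (hF.mono (Icc_subset_Icc le_rfl hs.2)) (hpc s)
  have e2 := rlIntegral_sub (add_nonneg ha hb) ht hF (hpc t)
  have e3 : rlIntegral a (rlIntegral b F) t - rlIntegral (a + b) F t =
      rlIntegral a (rlIntegral b D) t - rlIntegral (a + b) D t := by
    rw [e1, hD, e2, rlIntegral_rlIntegral_polynomial ha hb ht]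
    ring
  rw [e3]
  calc _ ≤ _ := abs_sub _ _
    _ ≤ _ := add_le_add h2 h3
    _ = ε / (A + 1) * A := by rw [hA]; ring
    _ ≤ ε := by
      rw [div_mul_eq_mul_div, div_le_iff₀ (by positivity)]
      nlinarith

theorem hasDerivWithinAt_integral_Icc {T : ℝ} {F : ℝ → ℝ} (hF : ContinuousOn F (Icc 0 T))
    {t : ℝ} (ht : t ∈ Icc 0 T) :
    HasDerivWithinAt (fun z => ∫ s in (0 : ℝ)..z, F s) (F t) (Icc 0 T) t := by
  have : Fact (t ∈ Icc (0 : ℝ) T) := ⟨ht⟩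
  apply intervalIntegral.integral_hasDerivWithinAt_right
  · apply ContinuousOn.intervalIntegrable
    rw [uIcc_of_le ht.1]
    exact hF.mono (Icc_subset_Icc le_rfl ht.2)
  · exact hF.stronglyMeasurableAtFilter_nhdsWithin measurableSet_Icc t
  · exact hF t ht

/-- By the semigroup law `I^(1+a) F` is the primitive of the continuous function `I^a F`. -/
theorem hasDerivWithinAt_rlIntegral {a T : ℝ} (ha : 0 ≤ a) {F : ℝ → ℝ}
    (hF : ContinuousOn F (Icc 0 T)) {t : ℝ} (ht : t ∈ Icc 0 T) :
    HasDerivWithinAt (rlIntegral (1 + a) F) (rlIntegral a F t) (Icc 0 T) t := by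
  have e : ∀ z ∈ Icc 0 T, rlIntegral (1 + a) F z = ∫ s in (0 : ℝ)..z, rlIntegral a F s := by
    intro z hz
    rw [← rlIntegral_rlIntegral zero_le_one ha hz.1 (hF.mono (Icc_subset_Icc le_rfl hz.2)),
      rlIntegral_one]
  exact (hasDerivWithinAt_integral_Icc (continuousOn_rlIntegral ha hF) ht).congr e (e t ht)

/-! ### The Erdélyi-Kober integral -/

/-- The substitution `u = s ^ η` turns the Erdélyi-Kober integrand of a power into a beta integrand.
The indicators put both sides on the half-line, where the change of variables `s ↦ s ^ η` applies;
the Jacobian appears without its factor `η`, which returns as `η⁻¹` in the integral. -/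
theorem ekIntegrand_rpow_eq {η μ δ p t s : ℝ} (hη : 0 < η) (ht : 0 < t) (hs : 0 < s) :
    indicator (Ioo 0 t) (ekIntegrand η μ δ (fun s => s ^ p) t) s =
      s ^ (η - 1) • indicator (Ioo 0 (t ^ η))
        (fun u => (t ^ η - u) ^ (δ - 1) * u ^ (μ + p / η + 1 - 1)) (s ^ η) := by
  have hs' : 0 < s ^ η := Real.rpow_pos_of_pos hs η
  by_cases h : s < t
  · have h' : s ^ η < t ^ η := Real.rpow_lt_rpow hs.le h hη
    rw [indicator_of_mem (show s ∈ Ioo 0 t from ⟨hs, h⟩),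
      indicator_of_mem (show s ^ η ∈ Ioo 0 (t ^ η) from ⟨hs', h'⟩), ekIntegrand, smul_eq_mul,
      ← Real.rpow_mul hs.le, div_eq_mul_inv, ← Real.rpow_neg (by linarith), neg_sub,
      ← Real.rpow_add hs, mul_left_comm, mul_comm, ← Real.rpow_add hs]
    congr 2
    field_simp
    ring
  · have h' : ¬ s ^ η < t ^ η := not_lt.2 (Real.rpow_le_rpow ht.le (not_lt.1 h) hη.le)
    rw [indicator_of_notMem (fun hm => h hm.2), indicator_of_notMem (fun hm => h' hm.2),
      smul_zero]

theorem intervalIntegrable_ekIntegrand_rpow {η μ δ p t : ℝ} (hη : 0 < η) (hδ : 0 < δ)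
    (ht : 0 < t) (hp : 0 < μ + p / η + 1) :
    IntervalIntegrable (ekIntegrand η μ δ (fun s => s ^ p) t) volume 0 t := by
  have hb := intervalIntegrable_beta hδ hp (Real.rpow_pos_of_pos ht η)
  rw [intervalIntegrable_iff_integrableOn_Ioo_of_le (by positivity)] at hb ⊢
  have h1 := (integrable_indicator_iff measurableSet_Ioo).2 hb
  have h2 := (integrableOn_Ioi_comp_rpow_iff' _ hη.ne').2 h1.integrableOn
  have h3 := h2.congr_fun (fun s hs => (ekIntegrand_rpow_eq hη ht hs).symm) measurableSet_Ioi
  have h4 := h3.mono_set (show Ioo 0 t ⊆ Ioi 0 from fun s hs => hs.1)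
  exact h4.congr_fun (fun s hs => indicator_of_mem hs _) measurableSet_Ioo

theorem integral_ekIntegrand_rpow {η μ δ p t : ℝ} (hη : 0 < η) (hδ : 0 < δ)
    (ht : 0 < t) (hp : 0 < μ + p / η + 1) :
    ∫ s in (0 : ℝ)..t, ekIntegrand η μ δ (fun s => s ^ p) t s =
      η⁻¹ * ((t ^ η) ^ (δ + (μ + p / η + 1) - 1) *
        (Real.Gamma δ * Real.Gamma (μ + p / η + 1) / Real.Gamma (δ + (μ + p / η + 1)))) := by
  have hIoo : ∀ r : ℝ, Ioi 0 ∩ Ioo 0 r = Ioo 0 r := fun r =>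
    inter_eq_right.2 fun s hs => hs.1
  rw [← integral_beta hδ hp (Real.rpow_pos_of_pos ht η),
    intervalIntegral.integral_of_le ht.le, intervalIntegral.integral_of_le (by positivity),
    integral_Ioc_eq_integral_Ioo, integral_Ioc_eq_integral_Ioo, ← hIoo t, ← hIoo (t ^ η),
    ← setIntegral_indicator measurableSet_Ioo, ← setIntegral_indicator measurableSet_Ioo,
    ← integral_comp_rpow_Ioi_of_pos hη (g := indicator (Ioo 0 (t ^ η))
      fun u => (t ^ η - u) ^ (δ - 1) * u ^ (μ + p / η + 1 - 1)), ← integral_const_mul]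
  refine setIntegral_congr_fun measurableSet_Ioi fun s hs => ?_
  rw [ekIntegrand_rpow_eq hη ht hs, smul_eq_mul, smul_eq_mul, mul_assoc,
    inv_mul_cancel_left₀ hη.ne']

theorem erdelyiKober_rpow {η μ δ p t : ℝ} (hη : 0 < η) (hδ : 0 < δ)
    (ht : 0 < t) (hp : 0 < μ + p / η + 1) :
    erdelyiKober η μ δ (fun s => s ^ p) t =
      t ^ p * (Real.Gamma (μ + p / η + 1) / Real.Gamma (μ + p / η + δ + 1)) := by
  have hΓ := (Real.Gamma_pos_of_pos hδ).ne'
  have e : t ^ p = t ^ (-η * (δ + μ)) * (t ^ η) ^ (δ + (μ + p / η + 1) - 1) := by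
    rw [← Real.rpow_mul ht.le, ← Real.rpow_add ht]
    congr 1
    field_simp
    ring
  have e' : δ + (μ + p / η + 1) = μ + p / η + δ + 1 := by ring
  rw [erdelyiKober, integral_ekIntegrand_rpow hη hδ ht hp, e, e']
  field_simp

/-- The weight `s ^ (η * μ + η - 1)` may fail to be integrable at `0`, so a sup bound on `y` is not
enough. The decay `|y s| ≤ C s ^ p` compensates for it, exactly when `μ + p / η + 1 > 0`. -/
theorem abs_ekIntegrand_le {η μ δ p C t s : ℝ} (hη : 0 < η) {y : ℝ → ℝ}
    (hs : s ∈ Ioc 0 t) (hy : |y s| ≤ C * s ^ p) :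
    |ekIntegrand η μ δ y t s| ≤ C * ekIntegrand η μ δ (fun s => s ^ p) t s := by
  have h1 : 0 ≤ s ^ (η * μ + η - 1) := Real.rpow_nonneg hs.1.le _
  have h2 : 0 ≤ (t ^ η - s ^ η) ^ (1 - δ) :=
    Real.rpow_nonneg (sub_nonneg.2 (Real.rpow_le_rpow hs.1.le hs.2 hη.le)) _
  rw [ekIntegrand, ekIntegrand, abs_div, abs_mul, abs_of_nonneg h1, abs_of_nonneg h2,
    mul_div_assoc', mul_left_comm]
  gcongr

theorem intervalIntegrable_ekIntegrand {η μ δ p C t : ℝ} (hη : 0 < η) (hδ : 0 < δ)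
    (ht : 0 < t) (hp : 0 < μ + p / η + 1) {y : ℝ → ℝ} (hyc : ContinuousOn y (Icc 0 t))
    (hy : ∀ s ∈ Icc 0 t, |y s| ≤ C * s ^ p) :
    IntervalIntegrable (ekIntegrand η μ δ y t) volume 0 t := by
  have h := (intervalIntegrable_ekIntegrand_rpow hη hδ ht hp).const_mul C
  rw [intervalIntegrable_iff_integrableOn_Ioc_of_le ht.le] at h ⊢
  refine h.mono' ?_ ?_
  · have hym : AEStronglyMeasurable y (volume.restrict (Ioc 0 t)) :=
      (hyc.mono Ioc_subset_Icc_self).aestronglyMeasurable measurableSet_Ioc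
    have h1 : AEStronglyMeasurable (fun s : ℝ => s ^ (η * μ + η - 1))
        (volume.restrict (Ioc 0 t)) := by
      apply Measurable.aestronglyMeasurable; fun_prop
    have h2 : AEStronglyMeasurable (fun s : ℝ => ((t ^ η - s ^ η) ^ (1 - δ))⁻¹)
        (volume.restrict (Ioc 0 t)) := by
      apply Measurable.aestronglyMeasurable; fun_prop
    exact (h1.mul hym).mul h2
  · rw [ae_restrict_iff' measurableSet_Ioc]
    exact Filter.Eventually.of_forall fun s hs =>
      abs_ekIntegrand_le hη hs (hy s (Ioc_subset_Icc_self hs))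

theorem abs_erdelyiKober_le {η μ δ p C t : ℝ} (hη : 0 < η) (hδ : 0 < δ)
    (ht : 0 < t) (hp : 0 < μ + p / η + 1) {y : ℝ → ℝ}
    (hy : ∀ s ∈ Icc 0 t, |y s| ≤ C * s ^ p) :
    |erdelyiKober η μ δ y t| ≤ C * erdelyiKober η μ δ (fun s => s ^ p) t := by
  have h := intervalIntegral.norm_integral_le_of_norm_le (μ := volume) ht.le
    (f := ekIntegrand η μ δ y t)
    (Filter.Eventually.of_forall fun s hs =>
      abs_ekIntegrand_le hη hs (hy s (Ioc_subset_Icc_self hs)))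
    ((intervalIntegrable_ekIntegrand_rpow hη hδ ht hp).const_mul C)
  have hc : 0 ≤ η * t ^ (-η * (δ + μ)) / Real.Gamma δ := by
    have := Real.Gamma_pos_of_pos hδ
    positivity
  rw [intervalIntegral.integral_const_mul, Real.norm_eq_abs] at h
  rw [erdelyiKober, erdelyiKober, abs_mul, abs_of_nonneg hc, mul_left_comm]
  exact mul_le_mul_of_nonneg_left h hc

theorem ekIntegrand_const_mul_add (η μ δ c t : ℝ) (y z : ℝ → ℝ) :
    ekIntegrand η μ δ (fun s => c * y s + z s) t =
      fun s => c * ekIntegrand η μ δ y t s + ekIntegrand η μ δ z t s := by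
  funext s
  simp only [ekIntegrand]
  ring

theorem erdelyiKober_const_mul_add {η μ δ c t : ℝ} {y z : ℝ → ℝ}
    (hy : IntervalIntegrable (ekIntegrand η μ δ y t) volume 0 t)
    (hz : IntervalIntegrable (ekIntegrand η μ δ z t) volume 0 t) :
    erdelyiKober η μ δ (fun s => c * y s + z s) t =
      c * erdelyiKober η μ δ y t + erdelyiKober η μ δ z t := by
  rw [erdelyiKober, ekIntegrand_const_mul_add,
    intervalIntegral.integral_add (hy.const_mul c) hz, intervalIntegral.integral_const_mul,
    erdelyiKober, erdelyiKober]
  ring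

theorem ekIntegrand_congr {η μ δ t : ℝ} {y z : ℝ → ℝ} (h : EqOn y z (Icc 0 t)) :
    EqOn (ekIntegrand η μ δ y t) (ekIntegrand η μ δ z t) (Icc 0 t) := fun s hs => by
  simp only [ekIntegrand, h hs]

theorem erdelyiKober_congr {η μ δ t : ℝ} (ht : 0 ≤ t) {y z : ℝ → ℝ} (h : EqOn y z (Icc 0 t)) :
    erdelyiKober η μ δ y t = erdelyiKober η μ δ z t := by
  rw [erdelyiKober, erdelyiKober]
  congr 1
  exact intervalIntegral.integral_congr (by rw [uIcc_of_le ht]; exact ekIntegrand_congr h)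

/-- The fractional integral of a bounded function is in the domain of the Erdélyi-Kober
integral. -/
theorem intervalIntegrable_ekIntegrand_rlIntegral {α η μ δ t : ℝ} (hα : 0 ≤ α) (hη : 0 < η)
    (hδ : 0 < δ) (ht : 0 < t) (hp : 0 < μ + α / η + 1) {F : ℝ → ℝ}
    (hF : ContinuousOn F (Icc 0 t)) :
    IntervalIntegrable (ekIntegrand η μ δ (rlIntegral α F) t) volume 0 t := by
  obtain ⟨M, hM⟩ := isCompact_Icc.exists_bound_of_continuousOn hF
  refine intervalIntegrable_ekIntegrand (C := M / Real.Gamma (α + 1)) hη hδ ht hp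
    (continuousOn_rlIntegral hα hF) fun s hs => ?_
  refine (abs_rlIntegral_le hα hs.1 fun x hx => hM x ⟨hx.1, hx.2.trans hs.2⟩).trans_eq ?_
  ring

/-- The Erdélyi-Kober integral of `I^α F` depends Lipschitz continuously on `F`. -/
theorem abs_erdelyiKober_rlIntegral_sub_le {α η μ δ t M : ℝ} (hα : 0 ≤ α) (hη : 0 < η)
    (hδ : 0 < δ) (ht : 0 < t) (hp : 0 < μ + α / η + 1) {F G : ℝ → ℝ}
    (hF : ContinuousOn F (Icc 0 t)) (hG : ContinuousOn G (Icc 0 t))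
    (hM : ∀ s ∈ Icc 0 t, |F s - G s| ≤ M) :
    |erdelyiKober η μ δ (rlIntegral α F) t - erdelyiKober η μ δ (rlIntegral α G) t| ≤
      M / Real.Gamma (α + 1) * erdelyiKober η μ δ (fun s => s ^ α) t := by
  have h1 := erdelyiKober_const_mul_add (c := -1)
    (intervalIntegrable_ekIntegrand_rlIntegral hα hη hδ ht hp hG)
    (intervalIntegrable_ekIntegrand_rlIntegral hα hη hδ ht hp hF)
  have h2 : erdelyiKober η μ δ (rlIntegral α F) t - erdelyiKober η μ δ (rlIntegral α G) t =
      erdelyiKober η μ δ (fun s => -1 * rlIntegral α G s + rlIntegral α F s) t := by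
    rw [h1]; ring
  rw [h2]
  refine abs_erdelyiKober_le hη hδ ht hp fun s hs => ?_
  have hsub : Icc 0 s ⊆ Icc 0 t := Icc_subset_Icc le_rfl hs.2
  have h3 := rlIntegral_sub hα hs.1 (hF.mono hsub) (hG.mono hsub)
  have h4 := abs_rlIntegral_le hα hs.1 fun x hx => hM x (hsub hx)
  rw [h3] at h4
  calc _ = |rlIntegral α F s - rlIntegral α G s| := by congr 1; ring
    _ ≤ _ := h4
    _ = _ := by ring

/-! ### Weakly singular Volterra equations -/

/-- For `α ≥ 1` the kernel is bounded by `T ^ (α - 1) / Γ(α)`, and integrating `exp (k s)` gains a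
factor `1 / k`. Large `k` therefore makes `I^α` small in the weighted norm. -/
theorem abs_rlIntegral_le_exp {α k D T t : ℝ} (hα : 1 ≤ α) (hk : 0 < k) (ht : t ∈ Icc 0 T)
    {H : ℝ → ℝ} (hH : ∀ s ∈ Icc 0 t, |H s| ≤ D * Real.exp (k * s)) :
    |rlIntegral α H t| ≤ T ^ (α - 1) / Real.Gamma α * (D * (Real.exp (k * t) / k)) := by
  have hΓ := Real.Gamma_pos_of_pos (show 0 < α by linarith)
  have hD : 0 ≤ D := nonneg_of_mul_nonneg_left
    ((abs_nonneg _).trans (hH t ⟨ht.1, le_rfl⟩)) (Real.exp_pos _)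
  have hT0 : 0 ≤ T ^ (α - 1) := Real.rpow_nonneg (ht.1.trans ht.2) _
  have h := intervalIntegral.norm_integral_le_of_norm_le (μ := volume) ht.1
    (f := fun s => (t - s) ^ (α - 1) * H s)
    (g := fun s => T ^ (α - 1) * D * Real.exp (k * s))
    (Filter.Eventually.of_forall fun s hs => by
      have h0 : 0 ≤ (t - s) ^ (α - 1) := Real.rpow_nonneg (by linarith [hs.2]) _
      have h1 : (t - s) ^ (α - 1) ≤ T ^ (α - 1) :=
        Real.rpow_le_rpow (by linarith [hs.2]) (by linarith [hs.1, ht.2]) (by linarith)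
      rw [norm_mul, Real.norm_of_nonneg h0, mul_assoc]
      exact mul_le_mul h1 (hH s ⟨hs.1.le, hs.2⟩) (abs_nonneg _) hT0)
    (Continuous.intervalIntegrable (by fun_prop) _ _)
  have hexp : ∫ s in (0 : ℝ)..t, Real.exp (k * s) ≤ Real.exp (k * t) / k := by
    rw [intervalIntegral.integral_comp_mul_left _ hk.ne', integral_exp, smul_eq_mul,
      div_eq_inv_mul]
    gcongr
    simp
  rw [intervalIntegral.integral_const_mul, Real.norm_eq_abs] at h
  rw [rlIntegral, if_neg (by linarith), abs_mul, abs_of_pos (one_div_pos.2 hΓ)]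
  calc _ ≤ 1 / Real.Gamma α * (T ^ (α - 1) * D * (Real.exp (k * t) / k)) := by
        refine mul_le_mul_of_nonneg_left (h.trans ?_) (by positivity)
        gcongr
    _ = _ := by ring

/-- For Lipschitz `f`, the Volterra equation `x = c t^p + I^α f(·, x)` has for each `c` a
continuous solution on `[0, T]`, depending Lipschitz continuously on `c`. -/
theorem exists_volterra_family {α T L p : ℝ} (hα : 1 ≤ α) (hT : 0 < T) (hL : 0 < L) (hp : 0 ≤ p)
    {f : ℝ → ℝ → ℝ} (hf : ContinuousOn (fun q : ℝ × ℝ => f q.1 q.2) (Icc 0 T ×ˢ univ))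
    (hfL : ∀ t ∈ Icc 0 T, ∀ x y : ℝ, |f t x - f t y| ≤ L * |x - y|) :
    ∃ (X : ℝ → ℝ → ℝ) (K : ℝ), (∀ c, ContinuousOn (X c) (Icc 0 T)) ∧
      (∀ c, ∀ t ∈ Icc 0 T, X c t = c * t ^ p + rlIntegral α (fun s => f s (X c s)) t) ∧
      ∀ c d, ∀ t ∈ Icc 0 T, |X c t - X d t| ≤ K * |c - d| := by
  have hα0 : 0 ≤ α := by linarith
  have hΓ := Real.Gamma_pos_of_pos (show 0 < α by linarith)
  have hTα : 0 < T ^ (α - 1) := Real.rpow_pos_of_pos hT _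
  -- Chosen so that `T ^ (α - 1) / Γ(α) * L / k = 1 / 2`, the contraction constant.
  set k : ℝ := 2 * L * T ^ (α - 1) / Real.Gamma α with hk
  have hk0 : 0 < k := by positivity
  -- The unknown is `z = exp (-k t) x`, so the plain sup distance of the `z` is the weighted
  -- distance of the `x`. `E` recovers `x` from `z`, after extending `z` constantly outside `[0,
  -- T]`.
  let E : C(Icc (0 : ℝ) T, ℝ) → ℝ → ℝ := fun z s => Real.exp (k * s) * IccExtend hT.le z s
  have hEc : ∀ z, Continuous (E z) := fun z => by
    have : Continuous (IccExtend hT.le z) := z.continuous.Icc_extend'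
    fun_prop
  have hEdist : ∀ z w s, |E z s - E w s| ≤ Real.exp (k * s) * dist z w := by
    intro z w s
    have : E z s - E w s = Real.exp (k * s) * (IccExtend hT.le z s - IccExtend hT.le w s) := by
      simp only [E]; ring
    rw [this, abs_mul, abs_of_pos (Real.exp_pos _)]
    exact mul_le_mul_of_nonneg_left (ContinuousMap.dist_apply_le_dist (f := z) (g := w) (projIcc 0 T hT.le s)) (Real.exp_pos _).le
  let N : C(Icc (0 : ℝ) T, ℝ) → ℝ → ℝ := fun z s => f s (E z s)
  have hNc : ∀ z, ContinuousOn (N z) (Icc 0 T) := fun z =>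
    hf.comp (f := fun s => (s, E z s)) (by have := hEc z; fun_prop) fun s hs => ⟨hs, mem_univ _⟩
  let Φ : ℝ → C(Icc (0 : ℝ) T, ℝ) → C(Icc (0 : ℝ) T, ℝ) := fun c z =>
    { toFun := (Icc 0 T).domRestrict fun t =>
        Real.exp (-(k * t)) * (c * t ^ p + rlIntegral α (N z) t)
      continuous_toFun := by
        apply ContinuousOn.domRestrict
        have h1 := continuousOn_rlIntegral hα0 (hNc z)
        have h2 : Continuous fun t : ℝ => t ^ p := Real.continuous_rpow_const hp
        have h3 : Continuous fun t : ℝ => Real.exp (-(k * t)) := by fun_prop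
        exact h3.continuousOn.mul ((h2.const_mul c).continuousOn.add h1) }
  have hΦ : ∀ c z (t : Icc (0 : ℝ) T), Φ c z t =
      Real.exp (-(k * t)) * (c * (t : ℝ) ^ p + rlIntegral α (N z) t) := fun c z t => rfl
  have hcontr : ∀ c, ContractingWith (1 / 2) (Φ c) := by
    refine fun c => ⟨by rw [← NNReal.coe_lt_coe]; norm_num,
      LipschitzWith.of_dist_le_mul fun z w => ?_⟩
    rw [ContinuousMap.dist_le (by positivity)]
    rintro ⟨t, ht⟩
    have hsub : Icc 0 t ⊆ Icc 0 T := Icc_subset_Icc le_rfl ht.2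
    have h1 := rlIntegral_sub hα0 ht.1 ((hNc z).mono hsub) ((hNc w).mono hsub)
    have h2 := abs_rlIntegral_le_exp (D := L * dist z w) hα hk0 ht
      (H := fun s => N z s - N w s) fun s hs => by
        refine (hfL s (hsub hs) _ _).trans ?_
        have := hEdist z w s
        calc _ ≤ L * (Real.exp (k * s) * dist z w) := by gcongr
          _ = _ := by ring
    rw [h1] at h2
    rw [Real.dist_eq, hΦ, hΦ]
    have h3 : Real.exp (-(k * t)) * (c * t ^ p + rlIntegral α (N z) t) -
        Real.exp (-(k * t)) * (c * t ^ p + rlIntegral α (N w) t) =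
        Real.exp (-(k * t)) * (rlIntegral α (N z) t - rlIntegral α (N w) t) := by ring
    simp only
    rw [h3, abs_mul, abs_of_pos (Real.exp_pos _)]
    calc _ ≤ Real.exp (-(k * t)) * (T ^ (α - 1) / Real.Gamma α *
            (L * dist z w * (Real.exp (k * t) / k))) := by gcongr
      _ = (Real.exp (-(k * t)) * Real.exp (k * t)) *
            (T ^ (α - 1) / Real.Gamma α * L / k * dist z w) := by ring
      _ = T ^ (α - 1) / Real.Gamma α * L / k * dist z w := by
        rw [← Real.exp_add, neg_add_cancel, Real.exp_zero, one_mul]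
      _ = _ := by
        congr 1
        rw [hk]
        push_cast
        field_simp
  have hΦc : ∀ c d z, dist (Φ c z) (Φ d z) ≤ T ^ p * |c - d| := by
    intro c d z
    rw [ContinuousMap.dist_le (by positivity)]
    rintro ⟨t, ht⟩
    rw [Real.dist_eq, hΦ, hΦ]
    have h3 : Real.exp (-(k * t)) * (c * t ^ p + rlIntegral α (N z) t) -
        Real.exp (-(k * t)) * (d * t ^ p + rlIntegral α (N z) t) =
        Real.exp (-(k * t)) * t ^ p * (c - d) := by ring
    simp only
    rw [h3, abs_mul, abs_mul, abs_of_pos (Real.exp_pos _),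
      abs_of_nonneg (Real.rpow_nonneg ht.1 _)]
    have h4 : Real.exp (-(k * t)) ≤ 1 := Real.exp_le_one_iff.2 (by nlinarith [ht.1])
    have h5 : t ^ p ≤ T ^ p := Real.rpow_le_rpow ht.1 ht.2 hp
    have h6 : 0 ≤ t ^ p := Real.rpow_nonneg ht.1 _
    have h7 : Real.exp (-(k * t)) * t ^ p ≤ T ^ p := by nlinarith
    exact mul_le_mul_of_nonneg_right h7 (abs_nonneg _)
  let z : ℝ → C(Icc (0 : ℝ) T, ℝ) := fun c => (hcontr c).fixedPoint
  have hz : ∀ c, Φ c (z c) = z c := fun c => (hcontr c).fixedPoint_isFixedPt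
  -- The factor `2` is `1 / (1 - 1/2)`, from the perturbation bound for fixed points of
  -- contractions.
  have hzd : ∀ c d, dist (z c) (z d) ≤ T ^ p * |c - d| * 2 := by
    intro c d
    have h := (hcontr c).fixedPoint_lipschitz_in_map (hcontr d) (hΦc c d)
    refine h.trans_eq ?_
    norm_num
    ring
  refine ⟨fun c => E (z c), Real.exp (k * T) * (T ^ p * 2), fun c => (hEc _).continuousOn, ?_, ?_⟩
  · intro c t ht
    have h1 : (z c) ⟨t, ht⟩ = Real.exp (-(k * t)) * (c * t ^ p + rlIntegral α (N (z c)) t) := by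
      rw [← hΦ c (z c) ⟨t, ht⟩, hz c]
    simp only [E, IccExtend_of_mem hT.le _ ht]
    rw [h1, ← mul_assoc, ← Real.exp_add, add_neg_cancel, Real.exp_zero, one_mul]
  · intro c d t ht
    have h1 : Real.exp (k * t) ≤ Real.exp (k * T) := by
      have := ht.2
      gcongr
    calc _ ≤ Real.exp (k * t) * dist (z c) (z d) := hEdist _ _ _
      _ ≤ Real.exp (k * T) * (T ^ p * |c - d| * 2) :=
        mul_le_mul h1 (hzd c d) dist_nonneg (Real.exp_pos _).le
      _ = _ := by ring

/-! ### The boundary value problem -/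

/-- `c t^(γ-1) + I^α F` has Hilfer derivative `F`. -/
theorem hasHilferDerivOn_of_eq {α β T c : ℝ} (hα : 1 < α) (hα' : α < 2) (hβ : 0 ≤ β)
    (hβ' : β ≤ 1) {x F : ℝ → ℝ} (hF : ContinuousOn F (Icc 0 T))
    (hx : ∀ t ∈ Icc 0 T, x t = c * t ^ (hilferGamma α β - 1) + rlIntegral α F t) :
    HasHilferDerivOn α β T x F := by
  have hα0 : 0 ≤ α := by linarith
  have hρ : 0 ≤ β * (2 - α) := mul_nonneg hβ (by linarith)
  have hρ' : 0 < 1 - β * (2 - α) := by nlinarith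
  have hτ : 0 ≤ (1 - β) * (2 - α) := mul_nonneg (by linarith) (by linarith)
  have hγ : 0 ≤ hilferGamma α β - 1 := by unfold hilferGamma; nlinarith
  have hmono : ∀ {t}, t ∈ Icc 0 T → ContinuousOn F (Icc 0 t) := fun ht =>
    hF.mono (Icc_subset_Icc le_rfl ht.2)
  have hy : ∀ t ∈ Icc 0 T, rlIntegral ((1 - β) * (2 - α)) x t =
      c * Real.Gamma (hilferGamma α β) * t + rlIntegral (1 + (1 - β * (2 - α))) F t := by
    intro t ht
    have hpow : Continuous fun s : ℝ => s ^ (hilferGamma α β - 1) :=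
      Real.continuous_rpow_const hγ
    -- The exponent `γ - 1` is the one that integration of order `2 - γ` raises to `1`.
    have e1 : (1 - β) * (2 - α) + (hilferGamma α β - 1) = 1 := by unfold hilferGamma; ring
    have e2 : (1 - β) * (2 - α) + α = 1 + (1 - β * (2 - α)) := by ring
    have h2 : Real.Gamma (1 + 1) = 1 := by norm_num
    rw [rlIntegral_congr ht.1 (fun s hs => hx s ⟨hs.1, hs.2.trans ht.2⟩),
      rlIntegral_add hτ ht.1 (hpow.const_mul c).continuousOn
        (continuousOn_rlIntegral hα0 (hmono ht)),
      rlIntegral_const_mul, rlIntegral_rpow hτ hγ ht.1,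
      rlIntegral_rlIntegral hτ hα0 ht.1 (hmono ht), e1, e2, h2, Real.rpow_one, sub_add_cancel,
      div_one, mul_assoc]
  have hc := continuousOn_rlIntegral hρ'.le hF
  refine ⟨fun t => c * Real.Gamma (hilferGamma α β) + rlIntegral (1 - β * (2 - α)) F t,
    continuousOn_const.add hc, fun t ht => ?_, fun t ht => ?_⟩
  · have h1 := (hasDerivWithinAt_id t (Icc 0 T)).const_mul (c * Real.Gamma (hilferGamma α β))
    have h2 := h1.add (hasDerivWithinAt_rlIntegral hρ'.le hF ht)
    rw [mul_one] at h2
    exact h2.congr hy (hy t ht)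
  -- With `ρ = β(2 - α)`, subtracting `u(0)` leaves `I^(1-ρ) F`, which vanishes at `0` because `1 -
  -- ρ > 0`; then `I^ρ I^(1-ρ) F = I^1 F`.
  · have h1 : ∀ z ∈ Icc 0 T, rlIntegral (β * (2 - α)) (fun s =>
        c * Real.Gamma (hilferGamma α β) + rlIntegral (1 - β * (2 - α)) F s -
          (c * Real.Gamma (hilferGamma α β) + rlIntegral (1 - β * (2 - α)) F 0)) z =
        ∫ s in (0 : ℝ)..z, F s := by
      intro z hz
      rw [rlIntegral_congr hz.1 (G := rlIntegral (1 - β * (2 - α)) F) fun s _ => by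
          simp only [rlIntegral_apply_zero hρ']; ring,
        rlIntegral_rlIntegral hρ hρ'.le hz.1 (hmono hz), add_sub_cancel, rlIntegral_one]
    exact (hasDerivWithinAt_integral_Icc hF ht).congr h1 (h1 t ht)

/-- A continuous bounded real function has a fixed point. -/
theorem exists_fixedPoint_of_bounded {g : ℝ → ℝ} (hg : Continuous g) {B : ℝ}
    (hB : ∀ c, |g c| ≤ B) : ∃ c, g c = c := by
  have hB0 : 0 ≤ B := (abs_nonneg _).trans (hB 0)
  -- `c - g c` is nonpositive at `-B` and nonnegative at `B`.
  obtain ⟨c, -, hc⟩ := intermediate_value_Icc (show -B ≤ B by linarith)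
    (f := fun c => c - g c) (by fun_prop)
    (show (0 : ℝ) ∈ Icc (-B - g (-B)) (B - g B) from
      ⟨by linarith [neg_le_of_abs_le (hB (-B))], by linarith [le_of_abs_le (hB B)]⟩)
  exact ⟨c, by simp only at hc; linarith⟩

/-- The coefficient of `t^(γ-1)` that a right-hand side `F` determines through the right boundary
condition. -/
noncomputable def bvpCoeff (α β T : ℝ) {m : ℕ} (σ η μ δ ξ : Fin m → ℝ) (F : ℝ → ℝ) : ℝ :=
  (∑ i, σ i * erdelyiKober (η i) (μ i) (δ i) (rlIntegral α F) (ξ i) - rlIntegral α F T) /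
    bvpDelta α β T σ η μ δ ξ

/-- `bvpCoeff` is Lipschitz in `F` for the sup norm on `[0, T]`. This serves twice: comparing `F c`
with `F d` gives continuity in the shooting parameter, and comparing `F c` with `0` gives the
uniform bound. -/
theorem exists_abs_bvpCoeff_sub_le {α β T : ℝ} (hα : 0 ≤ α) (hT : 0 ≤ T) {m : ℕ}
    {σ η μ δ ξ : Fin m → ℝ} (hη : ∀ i, 0 < η i) (hδ : ∀ i, 0 < δ i)
    (hξ : ∀ i, ξ i ∈ Ioo 0 T) (hμ : ∀ i, 0 < μ i + α / η i + 1) :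
    ∃ C, ∀ (F G : ℝ → ℝ) (M : ℝ), ContinuousOn F (Icc 0 T) → ContinuousOn G (Icc 0 T) →
      (∀ s ∈ Icc 0 T, |F s - G s| ≤ M) →
      |bvpCoeff α β T σ η μ δ ξ F - bvpCoeff α β T σ η μ δ ξ G| ≤ C * M := by
  refine ⟨(∑ i, |σ i| * (1 / Real.Gamma (α + 1) *
    erdelyiKober (η i) (μ i) (δ i) (fun s => s ^ α) (ξ i)) + T ^ α / Real.Gamma (α + 1)) /
    |bvpDelta α β T σ η μ δ ξ|, fun F G M hF hG hM => ?_⟩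
  have hsub : ∀ i, Icc 0 (ξ i) ⊆ Icc 0 T := fun i => Icc_subset_Icc le_rfl (hξ i).2.le
  have h1 : ∀ i, |σ i * erdelyiKober (η i) (μ i) (δ i) (rlIntegral α F) (ξ i) -
      σ i * erdelyiKober (η i) (μ i) (δ i) (rlIntegral α G) (ξ i)| ≤
      |σ i| * (1 / Real.Gamma (α + 1) *
        erdelyiKober (η i) (μ i) (δ i) (fun s => s ^ α) (ξ i)) * M := by
    intro i
    rw [← mul_sub, abs_mul, mul_assoc]
    refine mul_le_mul_of_nonneg_left ((abs_erdelyiKober_rlIntegral_sub_le hα (hη i) (hδ i)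
      (hξ i).1 (hμ i) (hF.mono (hsub i)) (hG.mono (hsub i))
      fun s hs => hM s (hsub i hs)).trans_eq ?_) (abs_nonneg _)
    ring
  have h2 := abs_rlIntegral_le hα hT hM
  rw [rlIntegral_sub hα hT hF hG] at h2
  rw [bvpCoeff, bvpCoeff, ← sub_div, abs_div, div_mul_eq_mul_div]
  refine div_le_div_of_nonneg_right ?_ (abs_nonneg _)
  rw [sub_sub_sub_comm, ← Finset.sum_sub_distrib, add_mul, Finset.sum_mul]
  refine (abs_sub _ _).trans (add_le_add ((Finset.abs_sum_le_sum_abs _ _).trans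
    (Finset.sum_le_sum fun i _ => h1 i)) (h2.trans_eq (mul_comm _ _)))

theorem mainTheorem2 (α β T : ℝ) (hα : 1 < α) (hα' : α < 2) (hβ : 0 ≤ β) (hβ' : β ≤ 1)
    (hT : 0 < T) (m : ℕ) (σ η μ δ ξ : Fin m → ℝ)
    (hη : ∀ i, 0 < η i) (hδ : ∀ i, 0 < δ i) (hξ : ∀ i, ξ i ∈ Set.Ioo 0 T)
    (hμ : ∀ i, 0 < μ i + (hilferGamma α β - 1) / η i + 1)
    (hΔ : bvpDelta α β T σ η μ δ ξ ≠ 0)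
    (f : ℝ → ℝ → ℝ)
    (H1 : ContinuousOn (fun p : ℝ × ℝ => f p.1 p.2) (Set.Icc 0 T ×ˢ Set.univ))
    (L : ℝ) (hL : 0 < L)
    (H2 : ∀ t ∈ Set.Icc 0 T, ∀ x y : ℝ, |f t x - f t y| ≤ L * |x - y|)
    (ψ : ℝ → ℝ) (hψ : ContinuousOn ψ (Set.Icc 0 T)) (hψ0 : ∀ t ∈ Set.Icc 0 T, 0 ≤ ψ t)
    (H3 : ∀ t ∈ Set.Icc 0 T, ∀ x : ℝ, |f t x| ≤ ψ t)
    (hLΛ : L * bvpLambda α β T σ η μ δ ξ < 1) :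
    ∃ x : ℝ → ℝ, IsBVPSolution α β T σ η μ δ ξ f x := by
  have hα0 : 0 ≤ α := by linarith
  have hγ : 0 < hilferGamma α β - 1 := by unfold hilferGamma; nlinarith
  -- Indeed `γ - 1 ≤ 1 < α`. The integrability condition at exponent `γ - 1` thus passes to exponent
  -- `α`, the decay rate of `I^α F` at `0`.
  have hγα : hilferGamma α β - 1 ≤ α := by unfold hilferGamma; nlinarith
  have hμα : ∀ i, 0 < μ i + α / η i + 1 := fun i => (hμ i).trans_le (by
    have := div_le_div_of_nonneg_right hγα (hη i).le
    linarith)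
  have h0T : (0 : ℝ) ∈ Icc 0 T := ⟨le_rfl, hT.le⟩
  have hTT : T ∈ Icc 0 T := ⟨hT.le, le_rfl⟩
  obtain ⟨X, K, hXc, hX, hXK⟩ := exists_volterra_family hα.le hT hL hγ.le H1 H2
  set F : ℝ → ℝ → ℝ := fun c s => f s (X c s)
  have hFc : ∀ c, ContinuousOn (F c) (Icc 0 T) := fun c =>
    H1.comp (f := fun s => (s, X c s)) (continuousOn_id.prodMk (hXc c))
      fun s hs => ⟨hs, mem_univ _⟩
  obtain ⟨M, hM⟩ := isCompact_Icc.exists_bound_of_continuousOn hψ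
  obtain ⟨C, hC⟩ := exists_abs_bvpCoeff_sub_le (β := β) (σ := σ) hα0 hT.le hη hδ hξ hμα
  -- shooting: choose `c` so that the Volterra solution meets the right boundary condition
  obtain ⟨c, hc⟩ : ∃ c, bvpCoeff α β T σ η μ δ ξ (F c) = c := by
    refine exists_fixedPoint_of_bounded (g := fun c => bvpCoeff α β T σ η μ δ ξ (F c))
      (B := |bvpCoeff α β T σ η μ δ ξ fun _ => 0| + C * M) ?_ fun c => ?_
    · refine (LipschitzWith.of_dist_le' (K := C * (L * K)) fun c d => ?_).continuous
      rw [Real.dist_eq, Real.dist_eq, mul_assoc C]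
      refine hC _ _ _ (hFc c) (hFc d) fun s hs => (H2 s hs _ _).trans ?_
      rw [mul_assoc]
      exact mul_le_mul_of_nonneg_left (hXK c d s hs) hL.le
    · have h := hC (F c) (fun _ => 0) M (hFc c) continuousOn_const fun s hs => by
        rw [sub_zero]
        exact (H3 s hs _).trans ((le_abs_self _).trans (hM s hs))
      have h' := abs_add_le (bvpCoeff α β T σ η μ δ ξ fun _ => 0)
        (bvpCoeff α β T σ η μ δ ξ (F c) - bvpCoeff α β T σ η μ δ ξ fun _ => 0)
      rw [add_sub_cancel] at h'
      linarith
  have hsub : ∀ i, Icc 0 (ξ i) ⊆ Icc 0 T := fun i => Icc_subset_Icc le_rfl (hξ i).2.le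
  have hi1 := fun i => intervalIntegrable_ekIntegrand_rpow (hη i) (hδ i) (hξ i).1 (hμ i)
  have hi2 := fun i => intervalIntegrable_ekIntegrand_rlIntegral hα0 (hη i) (hδ i) (hξ i).1
    (hμα i) ((hFc c).mono (hsub i))
  have hXeq : ∀ i, EqOn (X c)
      (fun s => c * s ^ (hilferGamma α β - 1) + rlIntegral α (F c) s) (Icc 0 (ξ i)) :=
    fun i s hs => hX c s (hsub i hs)
  refine ⟨X c, hXc c, hasHilferDerivOn_of_eq hα hα' hβ hβ' (hFc c) (hX c), ?_, fun i => ?_, ?_⟩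
  · rw [hX c 0 h0T, Real.zero_rpow hγ.ne', rlIntegral_apply_zero (by linarith)]
    ring
  · have h := ((hi1 i).const_mul c).add (hi2 i)
    refine h.congr fun s hs => ?_
    rw [uIoc_of_le (hξ i).1.le] at hs
    rw [ekIntegrand_congr (hXeq i) (Ioc_subset_Icc_self hs), ekIntegrand_const_mul_add]
  · have h1 : ∀ i, σ i * erdelyiKober (η i) (μ i) (δ i) (X c) (ξ i) =
        c * (σ i * ξ i ^ (hilferGamma α β - 1) *
          (Real.Gamma (μ i + (hilferGamma α β - 1) / η i + 1) /
            Real.Gamma (μ i + (hilferGamma α β - 1) / η i + δ i + 1))) +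
        σ i * erdelyiKober (η i) (μ i) (δ i) (rlIntegral α (F c)) (ξ i) := by
      intro i
      rw [erdelyiKober_congr (hξ i).1.le (hXeq i), erdelyiKober_const_mul_add (hi1 i) (hi2 i),
        erdelyiKober_rpow (hη i) (hδ i) (hξ i).1 (hμ i)]
      ring
    rw [Finset.sum_congr rfl fun i _ => h1 i, Finset.sum_add_distrib, ← Finset.mul_sum,
      hX c T hTT]
    -- Cleared of the denominator, the fixed-point equation is the right boundary condition with the
    -- terms in `c` collected in `c Δ`.
    rw [bvpCoeff, div_eq_iff hΔ, bvpDelta] at hc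
    linarith
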